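/- Let $X$ be a real or complex Banach space with scalar field $\mathbb K$, let $\mathcal L(X)$ be the bounded linear operators on $X$, and let $G$ be a semitopological semigroup (a semigroup with a topology for which multiplication is separately continuous). Let $\mathcal S=\{S_g : g\in G\}\subset\mathcal L(X)$ be a bounded representation of $G$ on $X$, i.e. $\sup_{g\in G}\|S_g\|<\infty$, $S_gS_h=S_{hg}$ for all $g,h\in G$, and $g\mapsto S_gx$ is continuous for every $x\in X$. Assume that $\mathcal S$, endowed with operator multiplication and the strong operator topology, is amenable: there is a continuous linear functional $m$ on the space $C_b(\mathcal S)$ of bounded continuous $\mathbb K$-valued functions on $\mathcal S$ with $\langle m,\mathbb 1\rangle=\|m\|=1$ and $\langle m,R_Tf\rangle=\langle m,L_Tf\rangle=\langle m,f\rangle$ for all $T\in\mathcal S$ and $f\in C_b(\mathcal S)$, where $R_Tf(U)=f(UT)$ and $L_Tf(U)=f(TU)$. If $\mathcal S$ is relatively compact in $\mathcal L(X)$ with respect to the weak operator topology, then $\mathcal S$ is mean ergodic: the closure $\overline{\mathrm{co}}\,\mathcal S$ of the convex hull of $\mathcal S$ in the strong operator topology contains a zero element, i.e. there is $P\in\overline{\mathrm{co}}\,\mathcal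 S$ with $QP=PQ=P$ for all $Q\in\overline{\mathrm{co}}\,\mathcal S$. -/

import Mathlib

open scoped BoundedContinuousFunction

noncomputable section

namespace ErgodicSemigroup

section Amenability

variable (𝕜 : Type*) [RCLike 𝕜]
variable {T : Type*} [Semigroup T] [TopologicalSpace T] [SeparatelyContinuousMul T]

variable {𝕜} in
/-- Right translation `R_g f (h) = f (h g)` on the bounded continuous functions of a
semitopological semigroup. -/
def rightTranslate (g : T) (f : T →ᵇ 𝕜) : T →ᵇ 𝕜 :=
  f.compContinuous ⟨fun h => h * g, continuous_mul_const g⟩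

variable {𝕜} in
/-- Left translation `L_g f (h) = f (g h)` on the bounded continuous functions of a
semitopological semigroup. -/
def leftTranslate (g : T) (f : T →ᵇ 𝕜) : T →ᵇ 𝕜 :=
  f.compContinuous ⟨fun h => g * h, continuous_const_mul g⟩

variable {𝕜} in
/-- A mean on `C_b(T)`: a continuous linear functional `m` with `⟨m, 1⟩ = ‖m‖ = 1`. -/
def IsMean {T : Type*} [TopologicalSpace T] (m : StrongDual 𝕜 (T →ᵇ 𝕜)) : Prop :=
  m 1 = 1 ∧ ‖m‖ = 1

variable {𝕜} in
/-- Right invariance of a functional on `C_b(T)`. -/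
def IsRightInvariant (m : StrongDual 𝕜 (T →ᵇ 𝕜)) : Prop :=
  ∀ (g : T) (f : T →ᵇ 𝕜), m (rightTranslate g f) = m f

variable {𝕜} in
/-- Left invariance of a functional on `C_b(T)`. -/
def IsLeftInvariant (m : StrongDual 𝕜 (T →ᵇ 𝕜)) : Prop :=
  ∀ (g : T) (f : T →ᵇ 𝕜), m (leftTranslate g f) = m f

variable (T) in
/-- A semitopological semigroup is amenable if there is a (two-sided) invariant mean on the
space of its `𝕜`-valued bounded continuous functions. -/
def IsAmenable : Prop :=
  ∃ m : StrongDual 𝕜 (T →ᵇ 𝕜), IsMean m ∧ IsRightInvariant m ∧ IsLeftInvariant m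

end Amenability

section Operators

variable {𝕜 X : Type*} [RCLike 𝕜] [NormedAddCommGroup X] [NormedSpace 𝕜 X]

/-- A bounded operator as an element of `𝓛(X)` with the strong operator topology (the topology of
pointwise norm convergence). -/
def toSOT (P : X →L[𝕜] X) : X →Lₚₜ[𝕜] X :=
  ContinuousLinearMap.toPointwiseConvergenceCLM 𝕜 (RingHom.id 𝕜) X X P

/-- An operator semigroup regarded as a semigroup carrying the strong operator topology (a type
synonym, because the coercion of a subsemigroup to a type carries the norm topology). -/
def WithSOT (𝒮 : Subsemigroup (X →L[𝕜] X)) : Type _ := 𝒮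

namespace WithSOT

variable (𝒮 : Subsemigroup (X →L[𝕜] X))

instance : Semigroup (WithSOT 𝒮) := inferInstanceAs (Semigroup 𝒮)

/-- The subspace topology inherited from `𝓛(X)` with the strong operator topology. -/
instance : TopologicalSpace (WithSOT 𝒮) :=
  TopologicalSpace.induced (fun S : WithSOT 𝒮 => toSOT S.1) inferInstance

instance : SeparatelyContinuousMul (WithSOT 𝒮) where
  continuous_const_mul {S} := continuous_induced_rng.2 <|
    (PointwiseConvergenceCLM.postcomp X S.1).continuous.comp continuous_induced_dom
  continuous_mul_const {S} := continuous_induced_rng.2 <|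
    (PointwiseConvergenceCLM.precomp X S.1).continuous.comp continuous_induced_dom

end WithSOT

/-- A set of operators is relatively compact in the weak operator topology if its closure in
`𝓛(X)` with respect to that topology is compact. -/
def IsRelativelyWOTCompact (A : Set (X →L[𝕜] X)) : Prop :=
  IsCompact (closure ((ContinuousLinearMapWOT.ofCLM : (X →L[𝕜] X) → (X →WOT[𝕜] X)) '' A))

/-- The closed convex hull of a set of operators, the closure being taken in `𝓛(X)` with respect
to the strong operator topology. -/
def closedConvexHullSOT [NormedSpace ℝ X] [IsScalarTower ℝ 𝕜 X] (A : Set (X →L[𝕜] X)) :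
    Set (X →L[𝕜] X) :=
  toSOT ⁻¹' closure (toSOT '' convexHull ℝ A)

/-- `P` is a mean ergodic projection of the operator semigroup `𝒮`: a zero element of the closed
convex hull of `𝒮`. -/
def IsMeanErgodicProjection [NormedSpace ℝ X] [IsScalarTower ℝ 𝕜 X]
    (𝒮 : Subsemigroup (X →L[𝕜] X)) (P : X →L[𝕜] X) : Prop :=
  P ∈ closedConvexHullSOT (𝒮 : Set (X →L[𝕜] X)) ∧
    ∀ Q ∈ closedConvexHullSOT (𝒮 : Set (X →L[𝕜] X)), Q * P = P ∧ P * Q = P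

/-- An operator semigroup is mean ergodic if its closed convex hull contains a zero element. -/
def IsMeanErgodic [NormedSpace ℝ X] [IsScalarTower ℝ 𝕜 X]
    (𝒮 : Subsemigroup (X →L[𝕜] X)) : Prop :=
  ∃ P : X →L[𝕜] X, IsMeanErgodicProjection 𝒮 P

variable (𝕜 X) in
/-- A bounded representation `(S_g)` of a semitopological semigroup `G` on `X`. Note the order
of the factors in `S_g S_h = S_{hg}`. -/
structure BoundedRepresentation (G : Type*) [Semigroup G] [TopologicalSpace G] where
  /-- The operators `S_g`. -/
  op : G → X →L[𝕜] X
  bounded : ∃ M : ℝ, ∀ g, ‖op g‖ ≤ M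
  op_mul_op : ∀ g h, op g * op h = op (h * g)
  continuous_op : ∀ x, Continuous fun g => op g x

/-- The operator semigroup `𝒮 = {S_g : g ∈ G}`. -/
def BoundedRepresentation.semigroup {G : Type*} [Semigroup G] [TopologicalSpace G]
    (S : BoundedRepresentation 𝕜 X G) : Subsemigroup (X →L[𝕜] X) where
  carrier := Set.range S.op
  mul_mem' := by
    rintro _ _ ⟨g, rfl⟩ ⟨h, rfl⟩
    exact ⟨h * g, (S.op_mul_op g h).symm⟩

end Operators

end ErgodicSemigroup

end

/-! Average the semigroup against the mean: `P` is defined weakly by ψ(Px) = Λ(U ↦ ψ(Ux)), where Λ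
is the real part of the invariant mean and ψ runs over real functionals. Left invariance gives QP =
P and right invariance PQ = P for Q in the semigroup; both identities survive convex combinations
and strong limits. Hahn–Banach separation in finite powers of X puts `P` in the closed convex hull.

The hard point is that the average lies in X and not merely in the bidual. On the compact
WOT-closure K the mean becomes a measure and A ↦ Ax is weakly continuous, so a Pettis integral is
needed (`exists_pettis_integral`). If Φ(ψ) = ∫ ψ∘u were at positive distance δ from X, Helly's
theorem would produce functionals φₙ in the unit ball, vanishing on ever larger finite subsets of
u(K), with Φ(φₙ) ≥ δ/2. Compactness forces φₙ∘u → 0 pointwise, and dominated convergence gives Φ(φₙ)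
→ 0, a contradiction. -/

open Filter Topology MeasureTheory

/-! ### Pettis integrals of weakly continuous maps on compact spaces -/

section Pettis

variable {X : Type*} [NormedAddCommGroup X] [NormedSpace ℝ X]

theorem LinearIsometry.exists_eq_or_exists_le_norm_sub {E F : Type*} [NormedAddCommGroup E]
    [NormedSpace ℝ E] [CompleteSpace E] [NormedAddCommGroup F] [NormedSpace ℝ F] (J : E →ₗᵢ[ℝ] F)
    (y : F) : (∃ x, J x = y) ∨ ∃ δ > 0, ∀ x, δ ≤ ‖y - J x‖ := by
  by_cases hmem : y ∈ closure (Set.range J)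
  · exact Or.inl (J.isometry.isClosedEmbedding.isClosed_range.closure_subset hmem)
  · rw [Metric.mem_closure_iff] at hmem
    push Not at hmem
    obtain ⟨δ, hδ, h⟩ := hmem
    exact Or.inr ⟨δ, hδ, fun x => by rw [← dist_eq_norm]; exact h _ ⟨x, rfl⟩⟩

/-- **Helly's theorem**: a functional at distance at least `δ` from the span of finitely many
functionals takes a value at least `δ / 2` on the unit ball of their common kernel. -/
theorem exists_eq_zero_on_finset_of_le_norm_sub {Y : Type*} [NormedAddCommGroup Y]
    [NormedSpace ℝ Y] (Φ : StrongDual ℝ Y) {δ : ℝ} (hδ : 0 < δ) (A : Finset (StrongDual ℝ Y))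
    (h : ∀ L ∈ Submodule.span ℝ (A : Set (StrongDual ℝ Y)), δ ≤ ‖Φ - L‖) :
    ∃ y : Y, ‖y‖ ≤ 1 ∧ (∀ L ∈ A, L y = 0) ∧ δ / 2 ≤ Φ y := by
  by_contra! hcon
  let N : Submodule ℝ Y := ⨅ L : A, LinearMap.ker (L : StrongDual ℝ Y).toLinearMap
  have hN : ∀ y, y ∈ N ↔ ∀ L ∈ A, L y = 0 := by
    intro y
    simp [N, Submodule.mem_iInf]
  have hnorm : ‖Φ.comp N.subtypeL‖ ≤ δ / 2 := by
    refine ContinuousLinearMap.opNorm_le_of_unit_norm (by positivity) fun y hy => ?_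
    have h1 : ‖(y : Y)‖ = 1 := hy
    have h2 := hcon y h1.le ((hN _).1 y.2)
    have h3 := hcon (-y) (by rw [norm_neg, h1]) ((hN _).1 (N.neg_mem y.2))
    rw [map_neg] at h3
    exact abs_le.2 ⟨by simp; linarith, by simpa using h2.le⟩
  -- A norm-preserving extension of Φ|N differs from Φ by a functional killing N, hence by an
  -- element of the span; Φ would then be within δ/2 of the span.
  obtain ⟨Φ', hext, hΦ'⟩ := exists_extension_norm_eq N (Φ.comp N.subtypeL)
  have hmem : (Φ - Φ').toLinearMap ∈
      Submodule.span ℝ (Set.range fun L : A => (L : StrongDual ℝ Y).toLinearMap) := by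
    refine mem_span_of_iInf_ker_le_ker fun y hy => ?_
    simpa [sub_eq_zero] using (hext ⟨y, hy⟩).symm
  have hspan : Submodule.span ℝ (Set.range fun L : A => (L : StrongDual ℝ Y).toLinearMap) ≤
      (Submodule.span ℝ (A : Set (StrongDual ℝ Y))).map (ContinuousLinearMap.coeLM ℝ) := by
    rw [Submodule.span_le]
    rintro _ ⟨L, rfl⟩
    exact ⟨L, Submodule.subset_span L.2, rfl⟩
  obtain ⟨L, hL, hLΦ⟩ := hspan hmem
  have hLΦ' : L = Φ - Φ' := ContinuousLinearMap.coe_injective hLΦ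
  have := h L hL
  rw [hLΦ', sub_sub_cancel, hΦ'] at this
  linarith

/-- A bidual element at positive distance from `X` stays bounded below on the unit balls of the
annihilators of all finite sets. -/
theorem exists_dual_eq_zero_on_finset_of_le_norm_sub
    (Φ : StrongDual ℝ (StrongDual ℝ X)) {δ : ℝ} (hδ : 0 < δ)
    (h : ∀ x, δ ≤ ‖Φ - NormedSpace.inclusionInDoubleDualLi (E := X) ℝ x‖) (A : Finset X) :
    ∃ ψ : StrongDual ℝ X, ‖ψ‖ ≤ 1 ∧ (∀ a ∈ A, ψ a = 0) ∧ δ / 2 ≤ Φ ψ := by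
  classical
  let J : X →ₗ[ℝ] StrongDual ℝ (StrongDual ℝ X) :=
    (NormedSpace.inclusionInDoubleDualLi (E := X) ℝ).toLinearMap
  have hspan : Submodule.span ℝ (A.image J : Set (StrongDual ℝ (StrongDual ℝ X))) ≤
      LinearMap.range J := by
    rw [Submodule.span_le, Finset.coe_image]
    exact Set.image_subset_range _ _
  obtain ⟨ψ, hψ, hzero, hle⟩ := exists_eq_zero_on_finset_of_le_norm_sub Φ hδ (A.image J)
    fun L hL => by
      obtain ⟨x, rfl⟩ := hspan hL
      exact h x
  exact ⟨ψ, hψ, fun a ha => hzero _ (Finset.mem_image_of_mem J ha), hle⟩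

variable {K : Type*} [TopologicalSpace K]

theorem exists_finset_forall_abs_sub_lt [CompactSpace K] {u : K → X}
    (hu : ∀ ψ : StrongDual ℝ X, Continuous fun k => ψ (u k))
    (s : Finset (StrongDual ℝ X)) {ε : ℝ} (hε : 0 < ε) :
    ∃ A : Finset K, ∀ k, ∃ a ∈ A, ∀ ψ ∈ s, |ψ (u k) - ψ (u a)| < ε := by
  obtain ⟨A, -, hA⟩ := isCompact_univ.elim_nhds_subcover
    (fun a => {k | ∀ ψ ∈ s, |ψ (u k) - ψ (u a)| < ε}) (fun a _ => by
      refine (Finset.eventually_all (l := 𝓝 a) s).2 fun ψ _ => ?_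
      have : Continuous fun k => |ψ (u k) - ψ (u a)| := ((hu ψ).sub continuous_const).abs
      exact this.continuousAt.eventually_lt continuousAt_const (by simpa using hε))
  refine ⟨A, fun k => ?_⟩
  obtain ⟨a, ha, hk⟩ := Set.mem_iUnion₂.1 (hA (Set.mem_univ k))
  exact ⟨a, ha, hk⟩

/-- Mazur: a norm-closed subspace is weakly closed. This upgrades weak approximation to the norm
approximation that bounded sequences of functionals respect. -/
theorem mem_closure_span_of_mem_closure {u : K → X}
    (hu : ∀ ψ : StrongDual ℝ X, Continuous fun k => ψ (u k)) {A : Set K} {k : K}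
    (hk : k ∈ closure A) : u k ∈ closure (Submodule.span ℝ (u '' A) : Set X) := by
  by_contra hcon
  obtain ⟨ψ, c, hlt, hc⟩ := geometric_hahn_banach_closed_point
    (Submodule.span ℝ (u '' A)).convex.closure isClosed_closure hcon
  have hle : k ∈ {k | ψ (u k) ≤ c} :=
    closure_minimal (fun a ha => (hlt _ (subset_closure (Submodule.subset_span ⟨a, ha, rfl⟩))).le)
      (isClosed_le (hu ψ) continuous_const) hk
  exact absurd hc (not_lt.2 hle)

/-- A bounded sequence of functionals, each vanishing on a set of points which suffices to
approximate the weakly compact set `u(K)` with respect to its predecessors, converges to zero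
pointwise on `u(K)`. -/
theorem tendsto_zero_of_approximating_zeros [CompactSpace K] {u : K → X}
    (hu : ∀ ψ : StrongDual ℝ X, Continuous fun k => ψ (u k))
    {φ : ℕ → StrongDual ℝ X} (hφ : ∀ n, ‖φ n‖ ≤ 1) {A : ℕ → Finset K}
    (happrox : ∀ n k, ∃ a ∈ A n, ∀ i ≤ n, |φ i (u k) - φ i (u a)| < 1 / (n + 1))
    (hzero : ∀ n m, n < m → ∀ a ∈ A n, φ m (u a) = 0) (k : K) :
    Tendsto (fun n => φ n (u k)) atTop (𝓝 0) := by
  choose a ha hak using fun n => happrox n k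
  -- A cluster point `f` of the approximants of `k` is indistinguishable from `k` by every `φ i`,
  -- yet lies in the closure of the points on which the `φ n` eventually vanish.
  obtain ⟨f, -, hf⟩ := isCompact_univ (f := map a atTop) (by simp)
  have hf' : MapClusterPt f atTop a := hf
  have heq : ∀ i, φ i (u k) = φ i (u f) := by
    intro i
    have h1 : Tendsto (fun n => φ i (u (a n))) atTop (𝓝 (φ i (u k))) := by
      rw [tendsto_iff_dist_tendsto_zero]
      refine squeeze_zero' (Eventually.of_forall fun _ => dist_nonneg) ?_
        tendsto_one_div_add_atTop_nhds_zero_nat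
      filter_upwards [eventually_ge_atTop i] with n hn
      rw [dist_comm, Real.dist_eq]
      exact (hak n i hn).le
    have h2 : MapClusterPt (φ i (u f)) atTop (fun n => φ i (u (a n))) :=
      MapClusterPt.continuousAt_comp (f := fun k => φ i (u k)) (hu (φ i)).continuousAt hf'
    exact (eq_of_nhds_neBot (ClusterPt.mono h2 h1)).symm
  have hmem : f ∈ closure (⋃ n, (A n : Set K)) :=
    mem_closure_iff_clusterPt.2 <| ClusterPt.mono hf <| by
      rw [le_principal_iff, mem_map]
      exact Eventually.of_forall fun n => Set.mem_iUnion.2 ⟨n, ha n⟩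
  simp_rw [heq]
  have hspan : ∀ y ∈ Submodule.span ℝ (u '' ⋃ n, (A n : Set K)), ∀ᶠ n in atTop, φ n y = 0 := by
    intro y hy
    induction hy using Submodule.span_induction with
    | mem y hy =>
      obtain ⟨b, hb, rfl⟩ := hy
      obtain ⟨n, hn⟩ := Set.mem_iUnion.1 hb
      filter_upwards [eventually_gt_atTop n] with m hm using hzero n m hm b hn
    | zero => simp
    | add x y _ _ hx hy => filter_upwards [hx, hy] with n h1 h2; rw [map_add, h1, h2, add_zero]
    | smul c x _ hx => filter_upwards [hx] with n h1; rw [map_smul, h1, smul_zero]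
  rw [Metric.tendsto_nhds]
  intro ε hε
  obtain ⟨y, hy, hdist⟩ := Metric.mem_closure_iff.1 (mem_closure_span_of_mem_closure hu hmem) ε hε
  filter_upwards [hspan y hy] with n hn
  rw [dist_zero_right, ← sub_zero (φ n (u f)), ← hn, ← map_sub]
  calc ‖φ n (u f - y)‖ ≤ 1 * ‖u f - y‖ := (φ n).le_of_opNorm_le (hφ n) _
    _ < ε := by rwa [one_mul, ← dist_eq_norm]

/-- Uniform boundedness, applied to the image of u(K) in the bidual. -/
theorem exists_norm_le_of_continuous_dual [CompactSpace K] {u : K → X}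
    (hu : ∀ ψ : StrongDual ℝ X, Continuous fun k => ψ (u k)) : ∃ C, ∀ k, ‖u k‖ ≤ C := by
  obtain ⟨C, hC⟩ := banach_steinhaus (g := fun k => NormedSpace.inclusionInDoubleDual ℝ X (u k))
    fun ψ => by
      obtain ⟨C, hC⟩ := isCompact_univ.exists_bound_of_continuousOn (hu ψ).continuousOn
      exact ⟨C, fun k => hC k (Set.mem_univ k)⟩
  exact ⟨C, fun k =>
    ((NormedSpace.inclusionInDoubleDualLi (E := X) ℝ).norm_map (u k)).symm.le.trans (hC k)⟩

theorem integrable_dual_of_compactSpace [CompactSpace K] [MeasurableSpace K]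
    [OpensMeasurableSpace K] (μ : Measure K) [IsFiniteMeasure μ] {u : K → X}
    (hu : ∀ ψ : StrongDual ℝ X, Continuous fun k => ψ (u k)) (ψ : StrongDual ℝ X) :
    Integrable (fun k => ψ (u k)) μ := by
  obtain ⟨C, hC⟩ := isCompact_univ.exists_bound_of_continuousOn (hu ψ).continuousOn
  exact Integrable.of_bound (hu ψ).aestronglyMeasurable C
    (Eventually.of_forall fun k => hC k (Set.mem_univ k))

/-- Weakly continuous functions from a compact space to a Banach space are Pettis integrable with
respect to every finite measure; this is the substance of **Krein's theorem**. -/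
theorem exists_pettis_integral [CompleteSpace X] [CompactSpace K] [MeasurableSpace K]
    [OpensMeasurableSpace K] (μ : Measure K) [IsFiniteMeasure μ] {u : K → X}
    (hu : ∀ ψ : StrongDual ℝ X, Continuous fun k => ψ (u k)) :
    ∃ x : X, ∀ ψ : StrongDual ℝ X, ψ x = ∫ k, ψ (u k) ∂μ := by
  obtain ⟨C, hC⟩ := exists_norm_le_of_continuous_dual hu
  have hint := integrable_dual_of_compactSpace μ hu
  let Φ : StrongDual ℝ (StrongDual ℝ X) := LinearMap.mkContinuous
    { toFun := fun ψ => ∫ k, ψ (u k) ∂μ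
      map_add' := fun ψ χ => by
        simp only [add_apply]
        exact integral_add (hint ψ) (hint χ)
      map_smul' := fun c ψ => by
        simp only [smul_apply]
        exact integral_const_mul c _ } (C * μ.real Set.univ) fun ψ => by
      refine (norm_integral_le_of_norm_le_const (C := C * ‖ψ‖) (Eventually.of_forall fun k => ?_)
        ).trans (le_of_eq (by ring))
      refine (ψ.le_opNorm _).trans ?_
      rw [mul_comm]
      exact mul_le_mul_of_nonneg_right (hC k) (norm_nonneg _)
  have hΦ : ∀ ψ, Φ ψ = ∫ k, ψ (u k) ∂μ := fun _ => rfl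
  obtain ⟨x, hx⟩ | ⟨δ, hδ, hdist⟩ := LinearIsometry.exists_eq_or_exists_le_norm_sub
    (NormedSpace.inclusionInDoubleDualLi (E := X) ℝ) Φ
  · exact ⟨x, fun ψ => by rw [← hΦ, ← hx]; rfl⟩
  exfalso
  classical
  choose F hF using fun (s : Finset (StrongDual ℝ X)) (n : ℕ) =>
    exists_finset_forall_abs_sub_lt hu s (Nat.one_div_pos_of_nat (α := ℝ) (n := n))
  choose next hnext_norm hnext_zero hnext_le using fun A : Finset K =>
    exists_dual_eq_zero_on_finset_of_le_norm_sub Φ hδ hdist (A.image u)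
  -- Each stage picks a functional vanishing on the points so far, then adds a finite net adequate
  -- for all functionals so far, the new one included.
  let state : ℕ → Finset (StrongDual ℝ X) × Finset K := fun n => Nat.rec (∅, ∅)
    (fun n p => (insert (next p.2) p.1, p.2 ∪ F (insert (next p.2) p.1) n)) n
  have hstate : ∀ n, state (n + 1) = (insert (next (state n).2) (state n).1,
    (state n).2 ∪ F (insert (next (state n).2) (state n).1) n) := fun _ => rfl
  let φ : ℕ → StrongDual ℝ X := fun n => next (state n).2
  have hmono1 : Monotone fun n => (state n).1 :=
    monotone_nat_of_le_succ fun n => by rw [hstate]; exact Finset.subset_insert _ _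
  have hmono2 : Monotone fun n => (state n).2 :=
    monotone_nat_of_le_succ fun n => by rw [hstate]; exact Finset.subset_union_left
  have hφmem : ∀ i n, i ≤ n → φ i ∈ (state (n + 1)).1 := fun i n hin =>
    hmono1 (Nat.succ_le_succ hin) (by
      change φ i ∈ (state (i + 1)).1
      rw [hstate]; exact Finset.mem_insert_self _ _)
  have htend : ∀ k, Tendsto (fun n => φ n (u k)) atTop (𝓝 0) := by
    refine tendsto_zero_of_approximating_zeros hu (fun n => hnext_norm _)
      -- The shift matters: stage n + 1 is the first whose points approximate K with respect to `φ
      -- n`.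
      (A := fun n => (state (n + 1)).2) (fun n k => ?_) fun n m hnm a ha => ?_
    · obtain ⟨a, ha, hka⟩ := hF (state (n + 1)).1 n k
      exact ⟨a, by rw [hstate]; exact Finset.mem_union_right _ ha,
        fun i hi => hka _ (hφmem i n hi)⟩
    · exact hnext_zero _ _ (Finset.mem_image_of_mem u (hmono2 (Nat.succ_le_of_lt hnm) ha))
  have hlim : Tendsto (fun n => ∫ k, φ n (u k) ∂μ) atTop (𝓝 (∫ _, (0 : ℝ) ∂μ)) := by
    refine tendsto_integral_of_dominated_convergence (fun _ => C)
      (fun n => (hint (φ n)).aestronglyMeasurable) (integrable_const C)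
      (fun n => Eventually.of_forall fun k => ?_) (Eventually.of_forall htend)
    exact ((φ n).le_of_opNorm_le (hnext_norm _) _).trans (by rw [one_mul]; exact hC k)
  rw [integral_zero] at hlim
  have := ge_of_tendsto hlim (Eventually.of_forall fun n => hnext_le (state n).2)
  linarith

/-- The Pettis integral of a weakly continuous function with respect to a positive functional. -/
theorem exists_forall_dual_eq_of_nonneg [CompleteSpace X] [CompactSpace K] [T2Space K] {u : K → X}
    (hu : ∀ ψ : StrongDual ℝ X, Continuous fun k => ψ (u k)) (Λ : C(K, ℝ) →ₗ[ℝ] ℝ)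
    (hΛ : ∀ f, 0 ≤ f → 0 ≤ Λ f) :
    ∃ x : X, ∀ ψ : StrongDual ℝ X, ψ x = Λ ⟨fun k => ψ (u k), hu ψ⟩ := by
  borelize K
  let Λ' : CompactlySupportedContinuousMap K ℝ →ₚ[ℝ] ℝ := PositiveLinearMap.mk₀
    { toFun := fun f => Λ f.toContinuousMap
      map_add' := fun f g => map_add Λ f.toContinuousMap g.toContinuousMap
      map_smul' := fun c f => map_smul Λ c f.toContinuousMap } fun f hf => hΛ _ hf
  obtain ⟨x, hx⟩ := exists_pettis_integral (RealRMK.rieszMeasure Λ') hu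
  refine ⟨x, fun ψ => (hx ψ).trans ?_⟩
  exact RealRMK.integral_rieszMeasure Λ'
    (CompactlySupportedContinuousMap.continuousMapEquiv ⟨fun k => ψ (u k), hu ψ⟩)

end Pettis

namespace ErgodicSemigroup

/-! ### From a scalar mean to a positive real functional -/

section RealMean

variable {𝕜 T : Type*} [RCLike 𝕜] [TopologicalSpace T]

/-- The real part of a functional on `C_b(T, 𝕜)`, as a functional on `C_b(T, ℝ)`. -/
noncomputable def rePart (m : StrongDual 𝕜 (T →ᵇ 𝕜)) : (T →ᵇ ℝ) →ₗ[ℝ] ℝ where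
  toFun f := RCLike.re (m (RCLike.ofRealCLM.compLeftContinuousBounded T f))
  map_add' f g := by simp only [map_add]
  map_smul' c f := by
    have : (RCLike.ofRealCLM (K := 𝕜)).compLeftContinuousBounded T (c • f) =
        (c : 𝕜) • (RCLike.ofRealCLM (K := 𝕜)).compLeftContinuousBounded T f := by
      ext t
      simp
    rw [this, map_smul, smul_eq_mul, RCLike.re_ofReal_mul]
    rfl

theorem rePart_one {m : StrongDual 𝕜 (T →ᵇ 𝕜)} (hm : IsMean m) : rePart m 1 = 1 := by
  have : (RCLike.ofRealCLM (K := 𝕜)).compLeftContinuousBounded T 1 = 1 := by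
    ext t
    simp
  change RCLike.re (m _) = 1
  rw [this, hm.1, RCLike.one_re]

/-- Since 0 ≤ f ≤ ‖f‖, the function ‖f‖ - f has norm at most ‖f‖; as ‖m‖ = 1, its mean ‖f‖ - Λf has
real part at most ‖f‖. -/
theorem rePart_nonneg {m : StrongDual 𝕜 (T →ᵇ 𝕜)} (hm : IsMean m) {f : T →ᵇ ℝ} (hf : 0 ≤ f) :
    0 ≤ rePart m f := by
  let F := (RCLike.ofRealCLM (K := 𝕜)).compLeftContinuousBounded T (‖f‖ • 1 - f)
  have hF : ‖F‖ ≤ ‖f‖ := by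
    refine (BoundedContinuousFunction.norm_le (norm_nonneg f)).2 fun t => ?_
    have h1 : 0 ≤ f t := hf t
    have h2 : f t ≤ ‖f‖ := (le_abs_self _).trans (f.norm_coe_le_norm t)
    have : F t = ((‖f‖ - f t : ℝ) : 𝕜) := by simp [F, RCLike.real_smul_eq_coe_mul]
    rw [this, RCLike.norm_ofReal, abs_le]
    constructor <;> linarith
  have h := (RCLike.re_le_norm (m F)).trans ((m.le_opNorm F).trans (by rw [hm.2, one_mul]))
  have h' : RCLike.re (m F) = ‖f‖ - rePart m f := by
    change rePart m (‖f‖ • 1 - f) = _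
    rw [map_sub, map_smul, rePart_one hm, smul_eq_mul, mul_one]
  linarith

theorem mean_mono {Λ : (T →ᵇ ℝ) →ₗ[ℝ] ℝ} (hpos : ∀ f, 0 ≤ f → 0 ≤ Λ f) {f g : T →ᵇ ℝ}
    (h : f ≤ g) : Λ f ≤ Λ g := by
  rw [← sub_nonneg, ← map_sub]
  exact hpos _ (sub_nonneg.2 h)

theorem mean_le_of_forall_le {Λ : (T →ᵇ ℝ) →ₗ[ℝ] ℝ} (hone : Λ 1 = 1)
    (hpos : ∀ f, 0 ≤ f → 0 ≤ Λ f) {f : T →ᵇ ℝ} {c : ℝ} (h : ∀ t, f t ≤ c) : Λ f ≤ c := by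
  refine (mean_mono hpos (g := c • 1) fun t => ?_).trans ?_
  · simpa using h t
  · rw [map_smul, hone, smul_eq_mul, mul_one]

theorem abs_mean_le {Λ : (T →ᵇ ℝ) →ₗ[ℝ] ℝ} (hone : Λ 1 = 1)
    (hpos : ∀ f, 0 ≤ f → 0 ≤ Λ f) {f : T →ᵇ ℝ} {c : ℝ} (h : ∀ t, |f t| ≤ c) : |Λ f| ≤ c := by
  refine abs_le.2 ⟨?_, mean_le_of_forall_le hone hpos fun t => (abs_le.1 (h t)).2⟩
  rw [neg_le, ← map_neg]
  exact mean_le_of_forall_le hone hpos fun t => neg_le.1 (abs_le.1 (h t)).1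

variable [Semigroup T] [SeparatelyContinuousMul T]

variable (T) in
/-- A positive normalised functional on the real bounded continuous functions which is invariant
under both translations. -/
structure RealInvariantMean where
  /-- The underlying functional. -/
  toFunctional : (T →ᵇ ℝ) →ₗ[ℝ] ℝ
  map_one : toFunctional 1 = 1
  nonneg : ∀ f, 0 ≤ f → 0 ≤ toFunctional f
  map_right : ∀ g f, toFunctional (rightTranslate g f) = toFunctional f
  map_left : ∀ g f, toFunctional (leftTranslate g f) = toFunctional f

theorem IsAmenable.nonempty_realInvariantMean (h : IsAmenable 𝕜 T) :
    Nonempty (RealInvariantMean T) := by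
  obtain ⟨m, hm, hr, hl⟩ := h
  refine ⟨⟨rePart m, rePart_one hm, fun f => rePart_nonneg hm, fun g f => ?_, fun g f => ?_⟩⟩
  · exact congrArg RCLike.re (hr g ((RCLike.ofRealCLM (K := 𝕜)).compLeftContinuousBounded T f))
  · exact congrArg RCLike.re (hl g ((RCLike.ofRealCLM (K := 𝕜)).compLeftContinuousBounded T f))

end RealMean

/-! ### The averaging operator and mean ergodicity -/

section MeanOperator

variable {𝕜 X : Type*} [RCLike 𝕜] [NormedAddCommGroup X] [NormedSpace 𝕜 X]

theorem WithSOT.continuous_apply (𝒮 : Subsemigroup (X →L[𝕜] X)) (x : X) :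
    Continuous fun U : WithSOT 𝒮 => U.1 x :=
  (PointwiseConvergenceCLM.evalCLM (RingHom.id 𝕜) X x).continuous.comp continuous_induced_dom

theorem continuous_ofCLM_WithSOT (𝒮 : Subsemigroup (X →L[𝕜] X)) :
    Continuous fun U : WithSOT 𝒮 => ContinuousLinearMapWOT.ofCLM U.1 :=
  ContinuousLinearMapWOT.continuous_of_dual_apply_continuous fun x φ =>
    φ.continuous.comp (WithSOT.continuous_apply 𝒮 x)

variable [NormedSpace ℝ X]

/-- The matrix coefficient `U ↦ ψ (U x)` of a bounded operator semigroup. -/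
noncomputable def coeff {𝒮 : Subsemigroup (X →L[𝕜] X)} {M : ℝ} (hM : ∀ U ∈ 𝒮, ‖U‖ ≤ M) (x : X)
    (ψ : StrongDual ℝ X) : WithSOT 𝒮 →ᵇ ℝ :=
  BoundedContinuousFunction.ofNormedAddCommGroup (fun U => ψ (U.1 x))
    (ψ.continuous.comp (WithSOT.continuous_apply 𝒮 x)) (‖ψ‖ * (M * ‖x‖)) fun U =>
      (ψ.le_opNorm _).trans (mul_le_mul_of_nonneg_left (U.1.le_of_opNorm_le (hM _ U.2) x)
        (norm_nonneg ψ))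

theorem coeff_apply {𝒮 : Subsemigroup (X →L[𝕜] X)} {M : ℝ} (hM : ∀ U ∈ 𝒮, ‖U‖ ≤ M) (x : X)
    (ψ : StrongDual ℝ X) (U : WithSOT 𝒮) : coeff hM x ψ U = ψ (U.1 x) := rfl

variable [IsScalarTower ℝ 𝕜 X]

/-- Every real functional is the real part of a 𝕜-linear one. -/
theorem continuous_real_dual_apply_WOT (x : X) (ψ : StrongDual ℝ X) :
    Continuous fun A : X →WOT[𝕜] X => ψ (A x) := by
  have h : ∀ y, ψ y = RCLike.re ((ψ.extendRCLike : StrongDual 𝕜 X) y) := fun y =>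
    (ψ.re_extendRCLike_apply y).symm
  simp_rw [h]
  exact RCLike.continuous_re.comp (ContinuousLinearMapWOT.continuous_dual_apply x _)

/-- If the semigroup is relatively weakly compact then the weak average of each orbit lies in
`X`. -/
theorem exists_forall_dual_eq_mean [CompleteSpace X] {𝒮 : Subsemigroup (X →L[𝕜] X)} {M : ℝ}
    (hM : ∀ U ∈ 𝒮, ‖U‖ ≤ M) (hcompact : IsRelativelyWOTCompact (𝒮 : Set (X →L[𝕜] X)))
    {Λ : (WithSOT 𝒮 →ᵇ ℝ) →ₗ[ℝ] ℝ} (hpos : ∀ f, 0 ≤ f → 0 ≤ Λ f) (x : X) :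
    ∃ y : X, ∀ ψ : StrongDual ℝ X, ψ y = Λ (coeff hM x ψ) := by
  let K := closure ((ContinuousLinearMapWOT.ofCLM : (X →L[𝕜] X) → (X →WOT[𝕜] X)) '' 𝒮)
  have : CompactSpace K := isCompact_iff_compactSpace.1 hcompact
  let ι : C(WithSOT 𝒮, K) :=
    ⟨fun U => ⟨ContinuousLinearMapWOT.ofCLM U.1, subset_closure ⟨U.1, U.2, rfl⟩⟩,
      (continuous_ofCLM_WithSOT 𝒮).subtype_mk _⟩
  -- Restricting functions from K to the semigroup turns the mean into a positive functional on
  -- C(K).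
  let Λ' : C(K, ℝ) →ₗ[ℝ] ℝ :=
    { toFun := fun f => Λ ((BoundedContinuousFunction.mkOfCompact f).compContinuous ι)
      map_add' := fun f g => by rw [← map_add]; rfl
      map_smul' := fun c f => by rw [RingHom.id_apply, ← map_smul]; rfl }
  obtain ⟨y, hy⟩ := exists_forall_dual_eq_of_nonneg (u := fun A : K => A.1 x)
    (fun ψ => (continuous_real_dual_apply_WOT x ψ).comp continuous_subtype_val) Λ'
    fun f hf => hpos _ fun U => hf (ι U)
  exact ⟨y, fun ψ => hy ψ⟩

/-- The weak average of a relatively weakly compact bounded operator semigroup. -/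
theorem exists_mean_operator [CompleteSpace X] {𝒮 : Subsemigroup (X →L[𝕜] X)} {M : ℝ}
    (hM : ∀ U ∈ 𝒮, ‖U‖ ≤ M) (hcompact : IsRelativelyWOTCompact (𝒮 : Set (X →L[𝕜] X)))
    {Λ : (WithSOT 𝒮 →ᵇ ℝ) →ₗ[ℝ] ℝ} (hone : Λ 1 = 1) (hpos : ∀ f, 0 ≤ f → 0 ≤ Λ f) :
    ∃ P : X →L[𝕜] X, ∀ x (ψ : StrongDual ℝ X), ψ (P x) = Λ (coeff hM x ψ) := by
  choose p hp using exists_forall_dual_eq_mean hM hcompact hpos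
  let P : X →ₗ[𝕜] X :=
    { toFun := p
      map_add' := fun x y => by
        refine (SeparatingDual.eq_iff_forall_dual_eq (R := ℝ)).2 fun ψ => ?_
        rw [map_add, hp, hp, hp, ← map_add]
        congr 1
        ext U
        simp [coeff_apply]
      map_smul' := fun c x => by
        refine (SeparatingDual.eq_iff_forall_dual_eq (R := ℝ)).2 fun ψ => ?_
        -- ψ is only real-linear, so the scalar `c` is absorbed into the functional.
        have h := hp x (ψ.comp ((c • ContinuousLinearMap.id 𝕜 X).restrictScalars ℝ))
        have h' : ψ (c • p x) = _ := h
        rw [RingHom.id_apply, h', hp]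
        congr 1
        ext U
        simp [coeff_apply] }
  refine ⟨P.mkContinuous |M| fun x => ?_, fun x ψ => hp x ψ⟩
  refine NormedSpace.norm_le_dual_bound ℝ _ (by positivity) fun ψ => ?_
  change ‖ψ (p x)‖ ≤ _
  rw [hp, Real.norm_eq_abs]
  refine abs_mean_le hone hpos fun U => ?_
  rw [coeff_apply, mul_comm]
  exact (ψ.le_opNorm _).trans (mul_le_mul_of_nonneg_left
    (U.1.le_of_opNorm_le ((hM _ U.2).trans (le_abs_self M)) x) (norm_nonneg ψ))

/-- A strong neighbourhood tests finitely many vectors, so separation takes place in a finite power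
of X. There a functional is a sum of matrix coefficients, and a bound valid on the semigroup passes
to their mean. -/
theorem mean_operator_mem_closedConvexHullSOT {𝒮 : Subsemigroup (X →L[𝕜] X)} {M : ℝ}
    (hM : ∀ U ∈ 𝒮, ‖U‖ ≤ M) {Λ : (WithSOT 𝒮 →ᵇ ℝ) →ₗ[ℝ] ℝ} (hone : Λ 1 = 1)
    (hpos : ∀ f, 0 ≤ f → 0 ≤ Λ f) {P : X →L[𝕜] X}
    (hP : ∀ x (ψ : StrongDual ℝ X), ψ (P x) = Λ (coeff hM x ψ)) :
    P ∈ closedConvexHullSOT (𝒮 : Set (X →L[𝕜] X)) := by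
  classical
  change toSOT P ∈ closure _
  rw [(PointwiseConvergenceCLM.isEmbedding_coeFn (RingHom.id 𝕜) X X).isInducing
    |>.closure_eq_preimage_closure_image, Set.mem_preimage, mem_closure_iff]
  intro o ho hPo
  obtain ⟨I, v, hv, hvo⟩ := isOpen_pi_iff.1 ho _ hPo
  let E : (X →L[𝕜] X) →ₗ[ℝ] (I → X) :=
    { toFun := fun A i => A i
      map_add' := fun _ _ => rfl
      map_smul' := fun _ _ => rfl }
  have hmem : E P ∈ closure (E '' convexHull ℝ (𝒮 : Set (X →L[𝕜] X))) := by
    by_contra hcon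
    obtain ⟨ξ, c, hlt, hc⟩ := geometric_hahn_banach_closed_point
      ((convex_convexHull ℝ _).linear_image E).closure isClosed_closure hcon
    have hξ : ∀ y : I → X, ξ y =
        ∑ i, (ξ.comp (ContinuousLinearMap.single ℝ (fun _ : I => X) i)) (y i) := by
      intro y
      conv_lhs => rw [← Finset.univ_sum_single y, map_sum]
      rfl
    have hle : ξ (E P) ≤ c := by
      have : ξ (E P) = Λ (∑ i : I, coeff hM (i : X)
          (ξ.comp (ContinuousLinearMap.single ℝ (fun _ : I => X) i))) := by
        rw [hξ, map_sum]
        exact Finset.sum_congr rfl fun i _ => hP _ _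
      rw [this]
      refine mean_le_of_forall_le hone hpos fun U => ?_
      have h := hlt (E U.1) (subset_closure ⟨U.1, subset_convexHull ℝ _ U.2, rfl⟩)
      rw [hξ] at h
      rw [BoundedContinuousFunction.coe_sum, Finset.sum_apply]
      exact h.le
    exact absurd hc (not_lt.2 hle)
  obtain ⟨_, hy, A, hA, rfl⟩ := mem_closure_iff.1 hmem
    (Set.univ.pi fun i : I => v i) (isOpen_set_pi Set.finite_univ fun i _ => (hv i i.2).1)
    fun i _ => (hv i i.2).2
  exact ⟨_, hvo fun i hi => hy ⟨i, hi⟩ trivial, toSOT A, ⟨A, hA, rfl⟩, rfl⟩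

/-- An operator which is a zero element for a semigroup is one for its closed convex hull. -/
theorem zero_element_closedConvexHullSOT {A : Set (X →L[𝕜] X)} {P : X →L[𝕜] X}
    (hP : ∀ Q ∈ A, Q * P = P ∧ P * Q = P) :
    ∀ Q ∈ closedConvexHullSOT A, Q * P = P ∧ P * Q = P := by
  have hconv : ∀ Q ∈ convexHull ℝ A, Q * P = P ∧ P * Q = P := by
    have hC : Convex ℝ {Q : X →L[𝕜] X | Q * P = P ∧ P * Q = P} := by
      rintro Q ⟨h1, h2⟩ R ⟨h3, h4⟩ a b _ _ hab
      constructor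
      · rw [add_mul, smul_mul_assoc, smul_mul_assoc, h1, h3, ← add_smul, hab, one_smul]
      · rw [mul_add, mul_smul_comm, mul_smul_comm, h2, h4, ← add_smul, hab, one_smul]
    exact fun Q hQ => convexHull_min hP hC hQ
  intro Q hQ
  have heval : ∀ x, Continuous fun B : X →Lₚₜ[𝕜] X => B x := fun x =>
    (PointwiseConvergenceCLM.evalCLM (RingHom.id 𝕜) X x).continuous
  have hclosed : IsClosed {B : X →Lₚₜ[𝕜] X | ∀ x, B (P x) = P x ∧ P (B x) = P x} := by
    simp only [Set.ofPred_forall, Set.ofPred_and]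
    exact isClosed_iInter fun x => (isClosed_eq (heval _) continuous_const).inter
      (isClosed_eq (P.continuous.comp (heval x)) continuous_const)
  have := closure_minimal (s := toSOT '' convexHull ℝ A) (by
    rintro _ ⟨B, hB, rfl⟩ x
    exact ⟨DFunLike.congr_fun (hconv B hB).1 x, DFunLike.congr_fun (hconv B hB).2 x⟩) hclosed hQ
  exact ⟨ContinuousLinearMap.ext fun x => (this x).1, ContinuousLinearMap.ext fun x => (this x).2⟩

/-- A bounded, relatively weakly compact operator semigroup with an invariant mean is mean
ergodic. -/
theorem isMeanErgodic_of_isRelativelyWOTCompact [CompleteSpace X] {𝒮 : Subsemigroup (X →L[𝕜] X)} {M : ℝ}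
    (hM : ∀ U ∈ 𝒮, ‖U‖ ≤ M) (hcompact : IsRelativelyWOTCompact (𝒮 : Set (X →L[𝕜] X)))
    (hamenable : IsAmenable 𝕜 (WithSOT 𝒮)) : IsMeanErgodic 𝒮 := by
  obtain ⟨Λ⟩ := hamenable.nonempty_realInvariantMean
  obtain ⟨P, hP⟩ := exists_mean_operator hM hcompact Λ.map_one Λ.nonneg
  refine ⟨P, mean_operator_mem_closedConvexHullSOT hM Λ.map_one Λ.nonneg hP,
    zero_element_closedConvexHullSOT fun Q hQ => ⟨?_, ?_⟩⟩ <;>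
  · refine ContinuousLinearMap.ext fun x =>
      (SeparatingDual.eq_iff_forall_dual_eq (R := ℝ)).2 fun ψ => ?_
    -- Left invariance settles QP = P, with Q moved into the functional; right invariance settles PQ
    -- = P, with Q moved into the vector.
    first
    | exact (hP x (ψ.comp (Q.restrictScalars ℝ))).trans
        ((Λ.map_left (⟨Q, hQ⟩ : 𝒮) (coeff hM x ψ)).trans (hP x ψ).symm)
    | exact (hP (Q x) ψ).trans
        ((Λ.map_right (⟨Q, hQ⟩ : 𝒮) (coeff hM x ψ)).trans (hP x ψ).symm)

end MeanOperator

end ErgodicSemigroup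

theorem corollary1p9 {𝕜 G X : Type*} [RCLike 𝕜]
    [Semigroup G] [TopologicalSpace G] [SeparatelyContinuousMul G]
    [NormedAddCommGroup X] [NormedSpace 𝕜 X] [NormedSpace ℝ X] [IsScalarTower ℝ 𝕜 X]
    [CompleteSpace X]
    (S : ErgodicSemigroup.BoundedRepresentation 𝕜 X G)
    (hamenable : ErgodicSemigroup.IsAmenable 𝕜 (ErgodicSemigroup.WithSOT S.semigroup))
    (hcompact : ErgodicSemigroup.IsRelativelyWOTCompact (S.semigroup : Set (X →L[𝕜] X))) :
    ErgodicSemigroup.IsMeanErgodic S.semigroup := by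
  obtain ⟨M, hM⟩ := S.bounded
  refine ErgodicSemigroup.isMeanErgodic_of_isRelativelyWOTCompact (M := M) ?_ hcompact hamenable
  rintro _ ⟨g, rfl⟩
  exact hM g
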